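/- Let $G$ be a totally disconnected, locally compact (topological) group and let $\operatorname{End}(G)$ be the semigroup, under composition, of continuous homomorphisms $\alpha\colon G\to G$. For $\alpha\in\operatorname{End}(G)$ define the scale of $\alpha$ by $$s(\alpha)=\min\{[\alpha(U):\alpha(U)\cap U] \mid U\le G \text{ a compact open subgroup}\}.$$ Then $s(\alpha)$ is a well-defined positive integer (compact open subgroups exist and all these indices are finite), so that $s\colon \operatorname{End}(G)\to\mathbb{Z}^+$, and for every $\alpha\in\operatorname{End}(G)$: - **S1.** $s(\alpha)=1$ if and only if there is a compact open subgroup $U\le G$ with $\alpha(U)\le U$; - **S2.** $s(\alpha^n)=s(\alpha)^n$ for every $n\in\mathbb{N}=\{0,1,2,\dots\}$. -/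

import Mathlib

/-- The semigroup `End(G)` of continuous endomorphisms of a topological group `G`. Multiplication is
composition, so `α ^ n` is the `n`-fold iterate of `α`. -/
def ContEnd (G : Type*) [Group G] [TopologicalSpace G] : Submonoid (Monoid.End G) where
  carrier := {f | Continuous f}
  one_mem' := continuous_id
  mul_mem' := fun {f g} (hf : Continuous f) (hg : Continuous g) => by
    simpa [Monoid.End.coe_mul] using hf.comp hg

/-- `α(U)`, the image of the subgroup `U` under the endomorphism `α`. -/
def imageSubgroup {G : Type*} [Group G] [TopologicalSpace G] (α : ContEnd G) (U : Subgroup G) :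
    Subgroup G :=
  Subgroup.map (α : Monoid.End G) U

/-- The displacement index `[α(U) : α(U) ∩ U]`. (Mathlib's index is `0` when it is infinite.) -/
noncomputable def displacementIndex {G : Type*} [Group G] [TopologicalSpace G] (α : ContEnd G)
    (U : Subgroup G) : ℕ :=
  (imageSubgroup α U ⊓ U).relIndex (imageSubgroup α U)

/-- The scale `s(α)`, the minimum of the displacement indices of the compact open subgroups of `G`.
It is `0` exactly when there are no compact open subgroups or some displacement index is infinite;
hence `0 < scale α` says that the set is a nonempty set of finite indices, and then the infimum is
an attained minimum. -/
noncomputable def scale {G : Type*} [Group G] [TopologicalSpace G] (α : ContEnd G) : ℕ :=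
  sInf {m : ℕ | ∃ U : Subgroup G,
    IsCompact (U : Set G) ∧ IsOpen (U : Set G) ∧ m = displacementIndex α U}

/-!
For a compact open subgroup `U` put `U₋ₙ = {x ∈ U | f x, …, fⁿ x ∈ U}`. Each `U₋ₙ` is again compact
and open, and `[U₋ₙ : U₋₍ₙ₊₁₎]` is its displacement index, so `s(f) ^ n ≤ [U : U₋ₙ]` for every `U`.
The displacement index of `fⁿ` on `V` is only `[V : V ∩ f⁻ⁿ V]`, and `V ∩ f⁻ⁿ V` may be much larger
than `V₋ₙ`, because a trajectory may leave `V` and come back. If `V = V₊ V₋`, then, up to an element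
of `V₋ₙ`, such a trajectory is homoclinic: it comes out of `V₊` and ends in `V₋`. The homoclinic
elements generate a subgroup with compact `f`-invariant closure `L`, and one can choose `V` to be
normalized by `L`. For `M = L V` the elements of `L` never leave `M`, whence
`s(f) ^ n ≤ [M : M₋ₙ] = [V : V ∩ M₋ₙ] ≤ [V : V ∩ f⁻ⁿ V]`.

So the displacement indices of `fⁿ` on this `V` grow at least like `s(f) ^ n`. Passing to another
compact open subgroup changes them by a factor which does not depend on `n`. Applied to a subgroup
minimizing for `f ^ k`, this gives `s(f) ^ k ≤ s(f ^ k)`; the opposite inequality holds because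
displacement indices are submultiplicative.
-/

open Filter Topology Pointwise

namespace EndScale

section RelIndex

variable {G : Type*} [Group G] {H K L : Subgroup G}

theorem relIndex_le_relIndex_mul_relIndex (hHL : H.relIndex L ≠ 0) (hLK : L.relIndex K ≠ 0) :
    H.relIndex K ≤ H.relIndex L * L.relIndex K := by
  have hHLK : H.relIndex (L ⊓ K) ≠ 0 := fun h =>
    hHL (Subgroup.relIndex_eq_zero_of_le_right inf_le_left h)
  calc H.relIndex K ≤ (H ⊓ L).relIndex K := by
        refine Subgroup.relIndex_le_of_le_left inf_le_left ?_
        rw [← Subgroup.relIndex_inf_mul_relIndex]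
        exact mul_ne_zero hHLK hLK
    _ = H.relIndex (L ⊓ K) * L.relIndex K := (Subgroup.relIndex_inf_mul_relIndex H L K).symm
    _ ≤ H.relIndex L * L.relIndex K :=
        Nat.mul_le_mul_right _ (Subgroup.relIndex_le_of_le_right inf_le_left hHL)

theorem surjective_quotientSubgroupOfEmbeddingOfLE_iff (hKL : K ≤ L) :
    Function.Surjective (Subgroup.quotientSubgroupOfEmbeddingOfLE H hKL) ↔
      (L : Set G) ⊆ K * H := by
  constructor
  · intro hsurj x hx
    obtain ⟨q, hq⟩ := hsurj (QuotientGroup.mk ⟨x, hx⟩)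
    induction q using QuotientGroup.induction_on with
    | H k =>
      rw [Subgroup.quotientSubgroupOfEmbeddingOfLE_apply_mk, QuotientGroup.eq] at hq
      exact ⟨k, k.2, _, hq, mul_inv_cancel_left _ _⟩
  · intro hsub q
    induction q using QuotientGroup.induction_on with
    | H x =>
      obtain ⟨k, hk, h, hh, hkh⟩ := hsub x.2
      refine ⟨QuotientGroup.mk ⟨k, hk⟩, ?_⟩
      rw [Subgroup.quotientSubgroupOfEmbeddingOfLE_apply_mk, QuotientGroup.eq]
      simpa [Subgroup.mem_subgroupOf, ← hkh] using hh

theorem relIndex_eq_iff_subset_mul (hKL : K ≤ L) (hHL : H.relIndex L ≠ 0) :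
    H.relIndex K = H.relIndex L ↔ (L : Set G) ⊆ K * H := by
  have : Finite (L ⧸ H.subgroupOf L) := Nat.finite_of_card_ne_zero hHL
  have hinj := (Subgroup.quotientSubgroupOfEmbeddingOfLE H hKL).injective
  rw [← surjective_quotientSubgroupOfEmbeddingOfLE_iff hKL]
  exact ⟨fun h => ((Nat.bijective_iff_injective_and_card _).2 ⟨hinj, h⟩).2,
    fun h => ((Nat.bijective_iff_injective_and_card _).1 ⟨hinj, h⟩).2⟩

theorem exists_finite_subset_mul_of_relIndex_ne_zero (h : H.relIndex K ≠ 0) :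
    ∃ T ⊆ (K : Set G), T.Finite ∧ (K : Set G) ⊆ T * H := by
  have : Finite (K ⧸ H.subgroupOf K) := Nat.finite_of_card_ne_zero h
  refine ⟨Set.range fun q : K ⧸ H.subgroupOf K => (q.out : G),
    Set.range_subset_iff.2 fun q => q.out.2, Set.finite_range _, fun x hx => ?_⟩
  let q : K ⧸ H.subgroupOf K := QuotientGroup.mk ⟨x, hx⟩
  have hq : (q.out)⁻¹ * ⟨x, hx⟩ ∈ H.subgroupOf K := QuotientGroup.eq.1 (QuotientGroup.out_eq' q)
  exact ⟨q.out, Set.mem_range_self q, _, hq, mul_inv_cancel_left _ _⟩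

end RelIndex

section Trajectories

variable {G : Type*} [Group G]

/-- The iterate `f^[n]` as a homomorphism, so that subgroups can be mapped and pulled back
along it. -/
def iterateHom (f : G →* G) (n : ℕ) : G →* G where
  toFun := f^[n]
  map_one' := iterate_map_one f n
  map_mul' := iterate_map_mul f n

/-- The subgroup `U₋ₙ = ⋂ k ≤ n, f⁻ᵏ(U)` of the elements whose trajectory stays in `U` for `n`
steps. -/
def minusPartial (f : G →* G) (U : Subgroup G) (n : ℕ) : Subgroup G :=
  ⨅ k ≤ n, U.comap (iterateHom f k)

/-- The subgroup `U₋ = ⋂ n, U₋ₙ` of the elements whose trajectory stays in `U` forever. -/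
def minusPart (f : G →* G) (U : Subgroup G) : Subgroup G :=
  ⨅ n, minusPartial f U n

/-- The subgroup `Uₙ = fⁿ(U₋ₙ)` of the end points of trajectories of length `n` inside `U`. -/
def plusPartial (f : G →* G) (U : Subgroup G) (n : ℕ) : Subgroup G :=
  (minusPartial f U n).map (iterateHom f n)

/-- The subgroup `U₊ = ⋂ n, Uₙ` of the elements that are reached by arbitrarily long trajectories
inside `U`. For compact `U` they are the end points of infinite backward trajectories. -/
def plusPart (f : G →* G) (U : Subgroup G) : Subgroup G :=
  ⨅ n, plusPartial f U n

/-- The elements of `U₊` whose trajectory eventually stays in `U` forever; it may leave `U` in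
between. -/
def homoclinicCore (f : G →* G) (U : Subgroup G) : Subgroup G :=
  plusPart f U ⊓ ⨆ n, (minusPart f U).comap (iterateHom f n)

/-- The subgroup generated by the points on homoclinic trajectories, those which come out of `U₊`
and end in `U₋`. -/
def homoclinic (f : G →* G) (U : Subgroup G) : Subgroup G :=
  ⨆ n, (homoclinicCore f U).map (iterateHom f n)

/-- `U` is tidy above for `f` if `U = U₊ U₋`; only the nontrivial inclusion is recorded. -/
def TidyAbove (f : G →* G) (U : Subgroup G) : Prop :=
  (U : Set G) ⊆ plusPart f U * minusPart f U

variable {f : G →* G} {U V : Subgroup G} {n : ℕ} {x : G}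

@[simp]
theorem iterateHom_apply (f : G →* G) (n : ℕ) (x : G) : iterateHom f n x = f^[n] x := rfl

theorem iterateHom_zero (f : G →* G) : iterateHom f 0 = MonoidHom.id G := rfl

theorem iterateHom_succ (f : G →* G) (n : ℕ) :
    iterateHom f (n + 1) = (iterateHom f n).comp f := rfl

theorem iterateHom_succ' (f : G →* G) (n : ℕ) :
    iterateHom f (n + 1) = f.comp (iterateHom f n) :=
  MonoidHom.ext fun x => Function.iterate_succ_apply' f n x

theorem iterate_mem_of_map_le (h : U.map f ≤ U) (n : ℕ) (hx : x ∈ U) : f^[n] x ∈ U := by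
  induction n generalizing x with
  | zero => exact hx
  | succ _ ih => exact ih (h (Subgroup.mem_map_of_mem f hx))

theorem mem_minusPartial : x ∈ minusPartial f U n ↔ ∀ k ≤ n, f^[k] x ∈ U := by
  simp [minusPartial, Subgroup.mem_iInf]

theorem mem_minusPartial_succ :
    x ∈ minusPartial f U (n + 1) ↔ x ∈ U ∧ f x ∈ minusPartial f U n := by
  simp only [mem_minusPartial, ← Nat.lt_succ_iff, Nat.forall_lt_succ_left,
    Function.iterate_zero_apply, Function.iterate_succ_apply]

theorem minusPartial_zero : minusPartial f U 0 = U := by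
  ext x
  simp [mem_minusPartial]

theorem minusPartial_succ :
    minusPartial f U (n + 1) = minusPartial f U n ⊓ U.comap (iterateHom f (n + 1)) :=
  Nat.iInf_le_succ _ n

theorem minusPartial_antitone : Antitone (minusPartial f U) := fun _ _ hmn _ hx =>
  mem_minusPartial.2 fun k hk => mem_minusPartial.1 hx k (hk.trans hmn)

theorem minusPartial_le : minusPartial f U n ≤ U := fun _ hx => mem_minusPartial.1 hx 0 n.zero_le

theorem minusPartial_succ' :
    minusPartial f U (n + 1) = minusPartial f U n ⊓ (minusPartial f U n).comap f := by
  ext x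
  rw [Subgroup.mem_inf, Subgroup.mem_comap]
  exact ⟨fun hx => ⟨minusPartial_antitone n.le_succ hx, (mem_minusPartial_succ.1 hx).2⟩,
    fun hx => mem_minusPartial_succ.2 ⟨minusPartial_le hx.1, hx.2⟩⟩

theorem minusPartial_mono (hVU : V ≤ U) : minusPartial f V n ≤ minusPartial f U n := fun _ hx =>
  mem_minusPartial.2 fun k hk => hVU (mem_minusPartial.1 hx k hk)

theorem minusPartial_minusPartial (m n : ℕ) :
    minusPartial f (minusPartial f U m) n = minusPartial f U (m + n) := by
  ext x
  simp only [mem_minusPartial, ← Function.iterate_add_apply]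
  refine ⟨fun h k hk => ?_, fun h k hk j hj => h _ (by lia)⟩
  obtain ⟨i, j, hi, hj, rfl⟩ : ∃ i j, i ≤ m ∧ j ≤ n ∧ k = i + j :=
    ⟨min k m, k - min k m, by lia, by lia, by lia⟩
  exact h j hj i hi

theorem le_minusPartial (hVU : V ≤ U) (hV : V.map f ≤ V) (n : ℕ) : V ≤ minusPartial f U n :=
  fun _ hx => mem_minusPartial.2 fun k _ => hVU (iterate_mem_of_map_le hV k hx)

theorem relIndex_minusPartial_succ :
    (minusPartial f U (n + 1)).relIndex (minusPartial f U n) =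
      U.relIndex ((plusPartial f U n).map f) := by
  rw [minusPartial_succ, Subgroup.inf_relIndex_left, Subgroup.relIndex_comap, plusPartial,
    Subgroup.map_map, iterateHom_succ']

theorem relIndex_minusPartial_succ' :
    (minusPartial f U (n + 1)).relIndex (minusPartial f U n) =
      (minusPartial f U n).relIndex ((minusPartial f U n).map f) := by
  rw [minusPartial_succ', Subgroup.inf_relIndex_left, Subgroup.relIndex_comap]

theorem pow_le_relIndex_minusPartial {s : ℕ}
    (hs : ∀ n, s ≤ (minusPartial f U n).relIndex ((minusPartial f U n).map f)) (n : ℕ) :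
    s ^ n ≤ (minusPartial f U n).relIndex U := by
  induction n with
  | zero => simp [minusPartial_zero]
  | succ n ih =>
    rw [← Subgroup.relIndex_mul_relIndex _ _ _ (minusPartial_antitone n.le_succ) minusPartial_le,
      pow_succ', relIndex_minusPartial_succ']
    exact Nat.mul_le_mul (hs n) ih

theorem mem_minusPart : x ∈ minusPart f U ↔ ∀ k, f^[k] x ∈ U := by
  simp only [minusPart, Subgroup.mem_iInf, mem_minusPartial]
  exact ⟨fun h k => h k k le_rfl, fun h _ k _ => h k⟩

theorem minusPart_le : minusPart f U ≤ U := fun _ hx => mem_minusPart.1 hx 0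

theorem minusPart_mono (hVU : V ≤ U) : minusPart f V ≤ minusPart f U :=
  iInf_mono fun _ => minusPartial_mono hVU

theorem map_minusPart_le : (minusPart f U).map f ≤ minusPart f U := by
  rintro _ ⟨x, hx, rfl⟩
  exact mem_minusPart.2 fun k => mem_minusPart.1 hx (k + 1)

theorem plusPartial_zero : plusPartial f U 0 = U := by
  rw [plusPartial, minusPartial_zero, iterateHom_zero, Subgroup.map_id]

theorem plusPartial_succ : plusPartial f U (n + 1) = (plusPartial f U n).map f ⊓ U := by
  rw [plusPartial, plusPartial, minusPartial_succ, Subgroup.map_map, ← iterateHom_succ']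
  exact SetLike.coe_injective (Set.image_inter_preimage (iterateHom f (n + 1)) _ U)

theorem plusPartial_antitone : Antitone (plusPartial f U) := by
  refine antitone_nat_of_succ_le fun n => ?_
  induction n with
  | zero => rw [plusPartial_succ, plusPartial_zero]; exact inf_le_right
  | succ n ih =>
    calc plusPartial f U (n + 2) = (plusPartial f U (n + 1)).map f ⊓ U := plusPartial_succ
      _ ≤ (plusPartial f U n).map f ⊓ U := inf_le_inf_right U (Subgroup.map_mono ih)
      _ = plusPartial f U (n + 1) := plusPartial_succ.symm

theorem plusPart_le : plusPart f U ≤ U := (iInf_le _ 0).trans_eq plusPartial_zero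

theorem plusPart_mono (hVU : V ≤ U) : plusPart f V ≤ plusPart f U :=
  iInf_mono fun _ => Subgroup.map_mono (minusPartial_mono hVU)

theorem map_plusPart_inf_le : (plusPart f U).map f ⊓ U ≤ plusPart f U :=
  le_iInf fun n => calc
    (plusPart f U).map f ⊓ U ≤ (plusPartial f U n).map f ⊓ U :=
      inf_le_inf_right U (Subgroup.map_mono (iInf_le _ n))
    _ = plusPartial f U (n + 1) := plusPartial_succ.symm
    _ ≤ plusPartial f U n := plusPartial_antitone n.le_succ

theorem plusPart_le_map_inf_minusPartial (h : plusPart f U ≤ (plusPart f U).map f) (n : ℕ) :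
    plusPart f U ≤ (plusPart f U ⊓ minusPartial f U n).map (iterateHom f n) := by
  induction n with
  | zero =>
    rw [minusPartial_zero, inf_eq_left.2 plusPart_le, iterateHom_zero, Subgroup.map_id]
  | succ n ih =>
    intro x hx
    obtain ⟨y, hy, rfl⟩ := ih hx
    obtain ⟨w, hw, rfl⟩ := h hy.1
    exact ⟨w, ⟨hw, mem_minusPartial_succ.2 ⟨plusPart_le hw, hy.2⟩⟩, rfl⟩

theorem monotone_comap_iterateHom_of_map_le (h : U.map f ≤ U) :
    Monotone fun n => U.comap (iterateHom f n) :=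
  monotone_nat_of_le_succ fun n => by
    rw [iterateHom_succ', ← Subgroup.comap_comap]
    exact Subgroup.comap_mono (Subgroup.map_le_iff_le_comap.1 h)

theorem monotone_map_iterateHom_of_le_map (h : U ≤ U.map f) :
    Monotone fun n => U.map (iterateHom f n) :=
  monotone_nat_of_le_succ fun n => by
    rw [iterateHom_succ, ← Subgroup.map_map]
    exact Subgroup.map_mono h

theorem mem_homoclinicCore :
    x ∈ homoclinicCore f U ↔ x ∈ plusPart f U ∧ ∃ n, f^[n] x ∈ minusPart f U :=
  and_congr_right fun _ => Subgroup.mem_iSup_of_directed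
    (monotone_comap_iterateHom_of_map_le map_minusPart_le).directed_le

theorem homoclinicCore_mono (hVU : V ≤ U) : homoclinicCore f V ≤ homoclinicCore f U :=
  inf_le_inf (plusPart_mono hVU) (iSup_mono fun _ => Subgroup.comap_mono (minusPart_mono hVU))

theorem homoclinicCore_le_homoclinic : homoclinicCore f U ≤ homoclinic f U :=
  (Subgroup.map_id _).ge.trans (le_iSup (fun n => (homoclinicCore f U).map (iterateHom f n)) 0)

theorem map_homoclinic_le : (homoclinic f U).map f ≤ homoclinic f U := by
  rw [homoclinic, Subgroup.map_iSup]
  refine iSup_le fun n => ?_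
  rw [Subgroup.map_map, ← iterateHom_succ']
  exact le_iSup (fun n => (homoclinicCore f U).map (iterateHom f n)) (n + 1)

theorem homoclinicCore_le_map (h : plusPart f U ≤ (plusPart f U).map f) :
    homoclinicCore f U ≤ (homoclinicCore f U).map f := fun x hx => by
  obtain ⟨hx, n, hn⟩ := mem_homoclinicCore.1 hx
  obtain ⟨y, hy, rfl⟩ := h hx
  exact ⟨y, mem_homoclinicCore.2 ⟨hy, n + 1, hn⟩, rfl⟩

theorem map_homoclinicCore_inf_le : (homoclinicCore f U).map f ⊓ U ≤ homoclinicCore f U := by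
  rintro _ ⟨⟨x, hx, rfl⟩, hfx⟩
  obtain ⟨hx, n, hn⟩ := mem_homoclinicCore.1 hx
  refine mem_homoclinicCore.2 ⟨map_plusPart_inf_le ⟨⟨x, hx, rfl⟩, hfx⟩, n, ?_⟩
  rw [← Function.iterate_succ_apply, Function.iterate_succ_apply']
  exact map_minusPart_le (Subgroup.mem_map_of_mem f hn)

/-- Finitely many representatives of `f(Q)` modulo `Q` enter `S` after a common time `N`. From then
on, one more application of `f` contributes only a factor in `S`. -/
theorem exists_map_iterateHom_subset_mul {Q S : Subgroup G} (hQ : Q.relIndex (Q.map f) ≠ 0)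
    (hS : S.map f ≤ S) (hQS : ∀ x ∈ Q, ∃ n, f^[n] x ∈ S) :
    ∃ N, ∀ n ≥ N, (Q.map (iterateHom f n) : Set G) ⊆ S * Q.map (iterateHom f N) := by
  obtain ⟨T, hTQ, hT, hQT⟩ := exists_finite_subset_mul_of_relIndex_ne_zero hQ
  obtain ⟨N, hN⟩ : ∃ N, ∀ n ≥ N, ∀ t ∈ T, f^[n] t ∈ S := by
    refine eventually_atTop.1 ((eventually_all_finite hT).2 fun t ht => ?_)
    obtain ⟨y, hy, rfl⟩ := hTQ ht
    obtain ⟨m, hm⟩ := hQS y hy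
    filter_upwards [eventually_ge_atTop m] with n hn
    exact monotone_comap_iterateHom_of_map_le hS (hn.trans n.le_succ) hm
  refine ⟨N, fun n hn => ?_⟩
  induction n, hn using Nat.le_induction with
  | base => exact fun x hx => ⟨1, one_mem S, x, hx, one_mul x⟩
  | succ n hn ih =>
    rintro _ ⟨y, hy, rfl⟩
    obtain ⟨t, ht, z, hz, htz⟩ := hQT (Subgroup.mem_map_of_mem f hy)
    obtain ⟨s, hs, q, hq, hsq⟩ := ih (Subgroup.mem_map_of_mem (iterateHom f n) hz)
    refine ⟨f^[n] t * s, mul_mem (hN n hn t ht) hs, q, hq, ?_⟩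
    calc f^[n] t * s * q = f^[n] t * f^[n] z := by rw [mul_assoc]; exact congrArg _ hsq
      _ = f^[n + 1] y := by rw [← iterate_map_mul, Function.iterate_succ_apply, ← htz]

theorem subset_plusPart_mul_minusPartial (hplus : plusPart f U ≤ (plusPart f U).map f)
    (h : (U : Set G) ⊆ plusPart f U * U.comap f) (n : ℕ) :
    (U : Set G) ⊆ plusPart f U * minusPartial f U n := by
  induction n with
  | zero => exact fun x hx => ⟨1, one_mem _, x, by rwa [minusPartial_zero], one_mul x⟩
  | succ n ih =>
    intro x hx
    obtain ⟨w, hw, y, hy, rfl⟩ := h hx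
    obtain ⟨v, hv, z, hz, hvz⟩ := ih hy
    obtain ⟨u, hu, rfl⟩ := hplus hv
    have hfz : f (u⁻¹ * y) = z := by
      rw [map_mul, map_inv, ← hvz]
      exact inv_mul_cancel_left _ _
    have hyU : y ∈ U := (U.mul_mem_cancel_left (plusPart_le hw)).1 hx
    exact ⟨w * u, mul_mem hw hu, u⁻¹ * y,
      mem_minusPartial_succ.2 ⟨mul_mem (inv_mem (plusPart_le hu)) hyU, hfz ▸ hz⟩, by group⟩

/-- Write `x⁻¹ = u m` with `u ∈ U₊`, `m ∈ U₋` and `fⁿ(u⁻¹) = fⁿ(w) m'` with `w ∈ U₊ ∩ U₋ₙ`,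
`m' ∈ U₋`. Then `x = (m⁻¹ w) (w⁻¹ u⁻¹)`, and `w⁻¹ u⁻¹ ∈ U₊` is taken to `m'` by `fⁿ`. -/
theorem TidyAbove.inf_comap_subset_mul (hU : TidyAbove f U)
    (h : plusPart f U ≤ (plusPart f U).map f) (n : ℕ) :
    ((U ⊓ U.comap (iterateHom f n) : Subgroup G) : Set G) ⊆
      minusPartial f U n * homoclinicCore f U := by
  rintro x ⟨hx, hxn⟩
  obtain ⟨u, hu, m, hm, hum⟩ := hU (inv_mem hx)
  have hun : f^[n] u⁻¹ ∈ U := by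
    have hu_inv : u⁻¹ = m * x := by rw [← inv_inv x, ← hum]; simp
    rw [hu_inv, iterate_map_mul]
    exact mul_mem (mem_minusPart.1 hm n) hxn
  obtain ⟨v, hv, m', hm', hvm⟩ := hU hun
  obtain ⟨w, ⟨hw, hwn⟩, rfl⟩ := plusPart_le_map_inf_minusPartial h n hv
  have hwu : f^[n] (w⁻¹ * u⁻¹) = m' := by
    rw [iterate_map_mul, ← hvm, iterate_map_inv]
    exact inv_mul_cancel_left _ _
  refine ⟨m⁻¹ * w, mul_mem (inv_mem ((iInf_le _ n : minusPart f U ≤ _) hm)) hwn, w⁻¹ * u⁻¹,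
    mem_homoclinicCore.2 ⟨mul_mem (inv_mem hw) (inv_mem hu), n, hwu ▸ hm'⟩, ?_⟩
  rw [← inv_inv x, ← hum]
  simp [mul_assoc]

end Trajectories

section CompactOpen

variable {G : Type*} [Group G] [TopologicalSpace G]

/-- A subgroup which is compact and open, the kind over which the scale is minimized. -/
structure IsCompactOpen (U : Subgroup G) : Prop where
  isCompact : IsCompact (U : Set G)
  isOpen : IsOpen (U : Set G)

theorem isCompact_map {f : G →* G} {K : Subgroup G} (hf : Continuous f)
    (hK : IsCompact (K : Set G)) : IsCompact (K.map f : Set G) :=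
  hK.image hf

theorem continuous_iterateHom {f : G →* G} (hf : Continuous f) (n : ℕ) :
    Continuous (iterateHom f n) :=
  hf.iterate n

theorem isOpen_minusPartial {f : G →* G} {U : Subgroup G} (hf : Continuous f)
    (hU : IsOpen (U : Set G)) (n : ℕ) : IsOpen (minusPartial f U n : Set G) := by
  induction n with
  | zero => rwa [minusPartial_zero]
  | succ n ih =>
    rw [minusPartial_succ]
    exact ih.inter (hU.preimage (continuous_iterateHom hf (n + 1)))

theorem exists_mem_iInf_of_forall_exists_mem [T2Space G] {K : ℕ → Subgroup G} (hK : Antitone K)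
    (hKc : ∀ n, IsCompact (K n : Set G)) {C : Set G} (hC : IsClosed C)
    (h : ∀ n, ∃ y ∈ K n, y ∈ C) : ∃ y ∈ ⨅ n, K n, y ∈ C := by
  obtain ⟨y, hy⟩ := IsCompact.nonempty_iInter_of_sequence_nonempty_isCompact_isClosed
    (fun n => (K n : Set G) ∩ C) (fun n => Set.inter_subset_inter_left _ (hK n.le_succ)) h
    ((hKc 0).inter_right hC) (fun n => (hKc n).isClosed.inter hC)
  rw [Set.mem_iInter] at hy
  exact ⟨y, Subgroup.mem_iInf.2 fun n => (hy n).1, (hy 0).2⟩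

variable [IsTopologicalGroup G]

theorem isOpen_stabilizer_of_isCompact_of_isOpen {X : Type*} [TopologicalSpace X] [MulAction G X]
    [ContinuousSMul G X] {W : Set X} (hWc : IsCompact W) (hWo : IsOpen W) :
    IsOpen (MulAction.stabilizer G W : Set G) := by
  refine Subgroup.isOpen_of_mem_nhds _ (g := 1) ?_
  have hsub : ∀ᶠ g : G in 𝓝 1, g • W ⊆ W := by
    have h : ∀ᶠ g : G in 𝓝 1, ∀ w ∈ W, g • w ∈ W :=
      hWc.eventually_forall_of_forall_eventually fun w hw =>
        (continuous_smul (M := G)).continuousAt.eventually (hWo.mem_nhds (by simpa using hw))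
    exact h.mono fun g hg => Set.smul_set_subset_iff.2 hg
  have hsub_inv : ∀ᶠ g : G in 𝓝 1, g⁻¹ • W ⊆ W :=
    (continuous_inv.tendsto' (1 : G) 1 inv_one).eventually hsub
  filter_upwards [hsub, hsub_inv] with g hg hg_inv
  exact hg.antisymm (Set.subset_smul_set_iff.2 hg_inv)

theorem exists_isCompactOpen [LocallyCompactSpace G] [TotallyDisconnectedSpace G] :
    ∃ U : Subgroup G, IsCompactOpen U := by
  obtain ⟨K, hK, hK1⟩ := exists_compact_mem_nhds (1 : G)
  obtain ⟨W, hW, hW1, hWK⟩ := (loc_compact_Haus_tot_disc_of_zero_dim (H := G)).mem_nhds_iff.1 hK1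
  have hWc : IsCompact W := hK.of_isClosed_subset hW.1 hWK
  have hopen := isOpen_stabilizer_of_isCompact_of_isOpen (G := G) hWc hW.2
  refine ⟨_, hWc.of_isClosed_subset (Subgroup.isClosed_of_isOpen _ hopen) fun g hg => ?_, hopen⟩
  rw [← MulAction.mem_stabilizer_iff.1 hg]
  exact ⟨1, hW1, mul_one g⟩

theorem exists_isOpen_le_normalizer {U L : Subgroup G} (hU : IsOpen (U : Set G))
    (hL : IsCompact (L : Set G)) :
    ∃ V ≤ U, IsOpen (V : Set G) ∧ L ≤ Subgroup.normalizer V := by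
  let V : Subgroup G := ⨅ l : L, U.comap (MulAut.conj (l : G)).toMonoidHom
  have mem_V : ∀ x, x ∈ V ↔ ∀ l ∈ L, l * x * l⁻¹ ∈ U := fun x => by
    simp [V, Subgroup.mem_iInf, Subgroup.mem_comap]
  refine ⟨V, fun x hx => by simpa using (mem_V x).1 hx 1 L.one_mem, ?_,
    Subgroup.le_normalizer_iff.2 fun l hl x hx => (mem_V _).2 fun m hm => ?_⟩
  · have h : ∀ᶠ x in 𝓝 (1 : G), ∀ l ∈ (L : Set G), l * x * l⁻¹ ∈ U := by
      refine hL.eventually_forall_of_forall_eventually fun l _ => ?_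
      have hconj : Continuous fun p : G × G => p.2 * p.1 * p.2⁻¹ := by fun_prop
      exact hconj.continuousAt.eventually (hU.mem_nhds (by simp))
    exact V.isOpen_of_mem_nhds (g := 1) (h.mono fun x hx => (mem_V x).2 hx)
  · simpa [mul_assoc] using (mem_V x).1 hx (m * l) (L.mul_mem hm hl)

theorem relIndex_ne_zero_of_isOpen_of_isCompact {U K : Subgroup G} (hU : IsOpen (U : Set G))
    (hK : IsCompact (K : Set G)) : U.relIndex K ≠ 0 := by
  have : CompactSpace K := isCompact_iff_compactSpace.1 hK
  have : Finite (K ⧸ U.subgroupOf K) :=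
    (U.subgroupOf K).quotient_finite_of_isOpen (hU.preimage continuous_subtype_val)
  exact Nat.card_pos.ne'

namespace IsCompactOpen

variable {f : G →* G} {U V L : Subgroup G}

theorem of_le (hU : IsCompactOpen U) (hVU : V ≤ U) (hV : IsOpen (V : Set G)) : IsCompactOpen V :=
  ⟨hU.isCompact.of_isClosed_subset (V.isClosed_of_isOpen hV) hVU, hV⟩

theorem sup_of_le_normalizer (hV : IsCompactOpen V) (hL : IsCompact (L : Set G))
    (hLV : L ≤ Subgroup.normalizer V) : IsCompactOpen (V ⊔ L) := by
  refine ⟨?_, Subgroup.isOpen_mono le_sup_left hV.isOpen⟩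
  rw [Subgroup.coe_mul_of_right_le_normalizer_left V L hLV]
  exact hV.isCompact.mul hL

theorem relIndex_map_ne_zero (hU : IsCompactOpen U) (hf : Continuous f) :
    U.relIndex (U.map f) ≠ 0 :=
  relIndex_ne_zero_of_isOpen_of_isCompact hU.isOpen (isCompact_map hf hU.isCompact)

protected theorem minusPartial (hU : IsCompactOpen U) (hf : Continuous f) (n : ℕ) :
    IsCompactOpen (minusPartial f U n) :=
  hU.of_le minusPartial_le (isOpen_minusPartial hf hU.isOpen n)

theorem isCompact_plusPartial (hU : IsCompactOpen U) (hf : Continuous f) (n : ℕ) :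
    IsCompact (plusPartial f U n : Set G) :=
  isCompact_map (continuous_iterateHom hf n) (hU.minusPartial hf n).isCompact

variable [T2Space G]

theorem isClosed_plusPart (hU : IsCompactOpen U) (hf : Continuous f) :
    IsClosed (plusPart f U : Set G) := by
  rw [plusPart, Subgroup.coe_iInf]
  exact isClosed_iInter fun n => (hU.isCompact_plusPartial hf n).isClosed

theorem plusPart_le_map (hU : IsCompactOpen U) (hf : Continuous f) :
    plusPart f U ≤ (plusPart f U).map f := fun x hx =>
  exists_mem_iInf_of_forall_exists_mem plusPartial_antitone (hU.isCompact_plusPartial hf)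
    (isClosed_singleton.preimage hf : IsClosed (f ⁻¹' {x})) fun n => by
      have hx' : x ∈ plusPartial f U (n + 1) := Subgroup.mem_iInf.1 hx (n + 1)
      rw [plusPartial_succ] at hx'
      exact hx'.1

end IsCompactOpen

end CompactOpen

section TidyAbove

variable {G : Type*} [Group G] [TopologicalSpace G] [IsTopologicalGroup G] {f : G →* G}
  {U V : Subgroup G}

theorem IsCompactOpen.exists_relIndex_map_plusPartial_eq (hU : IsCompactOpen U)
    (hf : Continuous f) :
    ∃ N, ∀ n, (minusPartial f U N).relIndex ((plusPartial f (minusPartial f U N) n).map f) =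
      (minusPartial f U N).relIndex ((minusPartial f U N).map f) := by
  have hanti : Antitone fun n => U.relIndex ((plusPartial f U n).map f) := fun m n hmn =>
    Subgroup.relIndex_le_of_le_right (Subgroup.map_mono (plusPartial_antitone hmn))
      (relIndex_ne_zero_of_isOpen_of_isCompact hU.isOpen
        (isCompact_map hf (hU.isCompact_plusPartial hf m)))
  obtain ⟨N, hN⟩ := WellFoundedLT.antitone_chain_condition hanti
  refine ⟨N, fun n => ?_⟩
  rw [← relIndex_minusPartial_succ, ← relIndex_minusPartial_succ', minusPartial_minusPartial,
    minusPartial_minusPartial, ← add_assoc, relIndex_minusPartial_succ, relIndex_minusPartial_succ,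
    ← hN _ (Nat.le_add_right N n), ← hN N le_rfl]

theorem IsCompactOpen.relIndex_homoclinicCore_ne_zero (hU : IsCompactOpen U) (hf : Continuous f) :
    (homoclinicCore f U).relIndex ((homoclinicCore f U).map f) ≠ 0 := by
  have hle : (homoclinicCore f U).map f ≤ U.map f :=
    Subgroup.map_mono (inf_le_left.trans plusPart_le)
  intro h0
  refine hU.relIndex_map_ne_zero hf (Subgroup.relIndex_eq_zero_of_le_right hle ?_)
  rw [← Subgroup.inf_relIndex_left]
  exact Subgroup.relIndex_eq_zero_of_le_left map_homoclinicCore_inf_le h0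

variable [T2Space G]

theorem IsCompactOpen.subset_plusPart_mul_comap (hU : IsCompactOpen U) (hf : Continuous f)
    (h : ∀ n, U.relIndex ((plusPartial f U n).map f) = U.relIndex (U.map f)) :
    (U : Set G) ⊆ plusPart f U * U.comap f := by
  intro x hx
  obtain ⟨w, hw, hwx⟩ : ∃ w ∈ plusPart f U, f (w⁻¹ * x) ∈ U := by
    refine exists_mem_iInf_of_forall_exists_mem plusPartial_antitone (hU.isCompact_plusPartial hf)
      (C := (fun w => f (w⁻¹ * x)) ⁻¹' U)
      ((U.isClosed_of_isOpen hU.isOpen).preimage (by fun_prop)) fun n => ?_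
    have hle : plusPartial f U n ≤ U :=
      (plusPartial_antitone n.zero_le).trans_eq plusPartial_zero
    obtain ⟨_, ⟨w, hw, rfl⟩, u, hu, hwu⟩ :=
      (relIndex_eq_iff_subset_mul (Subgroup.map_mono hle) (hU.relIndex_map_ne_zero hf)).1 (h n)
        (Subgroup.mem_map_of_mem f hx)
    refine ⟨w, hw, ?_⟩
    simpa [← hwu] using hu
  exact ⟨w, hw, w⁻¹ * x, hwx, mul_inv_cancel_left w x⟩

theorem IsCompactOpen.tidyAbove_of_forall_subset (hU : IsCompactOpen U) (hf : Continuous f)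
    (h : ∀ n, (U : Set G) ⊆ plusPart f U * minusPartial f U n) : TidyAbove f U := by
  intro x hx
  obtain ⟨y, hy, hxy⟩ : ∃ y ∈ minusPart f U, x * y⁻¹ ∈ plusPart f U := by
    refine exists_mem_iInf_of_forall_exists_mem minusPartial_antitone
      (fun n => (hU.minusPartial hf n).isCompact) (C := (fun y => x * y⁻¹) ⁻¹' plusPart f U)
      ((hU.isClosed_plusPart hf).preimage (by fun_prop)) fun n => ?_
    obtain ⟨w, hw, y, hy, rfl⟩ := h n hx
    exact ⟨y, hy, by simpa using hw⟩
  exact ⟨x * y⁻¹, hxy, y, hy, inv_mul_cancel_right x y⟩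

theorem IsCompactOpen.exists_tidyAbove_minusPartial (hU : IsCompactOpen U) (hf : Continuous f) :
    ∃ N, TidyAbove f (minusPartial f U N) := by
  obtain ⟨N, hN⟩ := hU.exists_relIndex_map_plusPartial_eq hf
  have hV := hU.minusPartial hf N
  exact ⟨N, hV.tidyAbove_of_forall_subset hf <| subset_plusPart_mul_minusPartial
    (hV.plusPart_le_map hf) (hV.subset_plusPart_mul_comap hf hN)⟩

theorem IsCompactOpen.exists_homoclinic_subset_mul (hU : IsCompactOpen U) (hf : Continuous f) :
    ∃ N, (homoclinic f U : Set G) ⊆ U * U.map (iterateHom f N) := by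
  have hmono := monotone_map_iterateHom_of_le_map (homoclinicCore_le_map (hU.plusPart_le_map hf))
  obtain ⟨N, hN⟩ := exists_map_iterateHom_subset_mul (hU.relIndex_homoclinicCore_ne_zero hf)
    map_minusPart_le fun x hx => (mem_homoclinicCore.1 hx).2
  refine ⟨N, fun x hx => ?_⟩
  obtain ⟨n, hn⟩ := (Subgroup.mem_iSup_of_directed hmono.directed_le).1 hx
  have hcore : homoclinicCore f U ≤ U := inf_le_left.trans plusPart_le
  exact Set.mul_subset_mul minusPart_le (Subgroup.map_mono hcore)
    (hN _ (le_max_right n N) (hmono (le_max_left n N) hn))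

theorem IsCompactOpen.isCompact_topologicalClosure_homoclinic (hU : IsCompactOpen U)
    (hf : Continuous f) : IsCompact ((homoclinic f U).topologicalClosure : Set G) := by
  obtain ⟨N, hN⟩ := hU.exists_homoclinic_subset_mul hf
  exact (hU.isCompact.mul (isCompact_map (continuous_iterateHom hf N)
    hU.isCompact)).closure_of_subset hN

end TidyAbove

section Growth

variable {G : Type*} [Group G] [TopologicalSpace G] [IsTopologicalGroup G] {f : G →* G}
  {U V L : Subgroup G}

theorem map_topologicalClosure_homoclinic_le (hf : Continuous f) :
    (homoclinic f U).topologicalClosure.map f ≤ (homoclinic f U).topologicalClosure := by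
  rintro _ ⟨x, hx, rfl⟩
  exact map_mem_closure hf hx fun y hy => map_homoclinic_le (Subgroup.mem_map_of_mem f hy)

theorem IsCompactOpen.pow_le_relIndex_map_iterateHom (hV : IsCompactOpen V)
    (hf : Continuous f) {s : ℕ}
    (hs : ∀ W : Subgroup G, IsCompactOpen W → s ≤ W.relIndex (W.map f))
    (hL : IsCompact (L : Set G)) (hfL : L.map f ≤ L) (hLV : L ≤ Subgroup.normalizer V) {n : ℕ}
    (hVL : ((V ⊓ V.comap (iterateHom f n) : Subgroup G) : Set G) ⊆ minusPartial f V n * L) :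
    s ^ n ≤ V.relIndex (V.map (iterateHom f n)) := by
  let M := V ⊔ L
  have hM : IsCompactOpen M := hV.sup_of_le_normalizer hL hLV
  have hLM : L ≤ minusPartial f M n := le_minusPartial le_sup_right hfL n
  have hreturn : V ⊓ V.comap (iterateHom f n) ≤ minusPartial f M n := fun x hx => by
    obtain ⟨y, hy, l, hl, rfl⟩ := hVL hx
    exact mul_mem (minusPartial_mono le_sup_left hy) (hLM hl)
  have hMV : (M : Set G) ⊆ V * minusPartial f M n := by
    rw [Subgroup.coe_mul_of_right_le_normalizer_left V L hLV]
    exact Set.mul_subset_mul_left hLM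
  have hret : (V ⊓ V.comap (iterateHom f n)).relIndex V = V.relIndex (V.map (iterateHom f n)) := by
    rw [Subgroup.inf_relIndex_left, Subgroup.relIndex_comap]
  calc s ^ n ≤ (minusPartial f M n).relIndex M :=
        pow_le_relIndex_minusPartial (fun k => hs _ (hM.minusPartial hf k)) n
    _ = (minusPartial f M n).relIndex V :=
        ((relIndex_eq_iff_subset_mul le_sup_left (relIndex_ne_zero_of_isOpen_of_isCompact
          (hM.minusPartial hf n).isOpen hM.isCompact)).2 hMV).symm
    _ ≤ (V ⊓ V.comap (iterateHom f n)).relIndex V :=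
        Subgroup.relIndex_le_of_le_left hreturn
          (hret.trans_ne (hV.relIndex_map_ne_zero (continuous_iterateHom hf n)))
    _ = V.relIndex (V.map (iterateHom f n)) := hret

theorem IsCompactOpen.exists_tidyAbove_le_normalizer [T2Space G] (hU : IsCompactOpen U)
    (hf : Continuous f) (hL : IsCompact (L : Set G)) (hfL : L.map f ≤ L) :
    ∃ V ≤ U, IsCompactOpen V ∧ TidyAbove f V ∧ L ≤ Subgroup.normalizer V := by
  obtain ⟨W, hWU, hWo, hLW⟩ := exists_isOpen_le_normalizer hU.isOpen hL
  have hW : IsCompactOpen W := hU.of_le hWU hWo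
  obtain ⟨N, htidy⟩ := hW.exists_tidyAbove_minusPartial hf
  refine ⟨minusPartial f W N, minusPartial_le.trans hWU, hW.minusPartial hf N, htidy,
    Subgroup.le_normalizer_iff.2 fun l hl x hx => mem_minusPartial.2 fun k hk => ?_⟩
  rw [iterate_map_mul, iterate_map_mul, iterate_map_inv]
  exact Subgroup.le_normalizer_iff.1 hLW _ (iterate_mem_of_map_le hfL k hl) _
    (mem_minusPartial.1 hx k hk)

theorem IsCompactOpen.exists_forall_pow_le_relIndex_map [T2Space G] (hU : IsCompactOpen U)
    (hf : Continuous f) {s : ℕ}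
    (hs : ∀ W : Subgroup G, IsCompactOpen W → s ≤ W.relIndex (W.map f)) :
    ∃ V : Subgroup G, IsCompactOpen V ∧ ∀ n, s ^ n ≤ V.relIndex (V.map (iterateHom f n)) := by
  have hL := hU.isCompact_topologicalClosure_homoclinic hf
  have hfL := map_topologicalClosure_homoclinic_le (U := U) hf
  obtain ⟨V, hVU, hV, htidy, hLV⟩ := hU.exists_tidyAbove_le_normalizer hf hL hfL
  have hcore : homoclinicCore f V ≤ (homoclinic f U).topologicalClosure :=
    (homoclinicCore_mono hVU).trans
      (homoclinicCore_le_homoclinic.trans (Subgroup.le_topologicalClosure _))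
  exact ⟨V, hV, fun n => hV.pow_le_relIndex_map_iterateHom hf hs hL hfL hLV <|
    (htidy.inf_comap_subset_mul (hV.plusPart_le_map hf) n).trans (Set.mul_subset_mul_left hcore)⟩

end Growth

section Scale

theorem le_of_forall_pow_le_mul_pow {R : Type*} [Field R] [LinearOrder R] [IsStrictOrderedRing R]
    [Archimedean R] {a b C : R} (hb : 0 < b) (h : ∀ n : ℕ, a ^ n ≤ C * b ^ n) : a ≤ b := by
  by_contra! hab
  obtain ⟨n, hn⟩ := pow_unbounded_of_one_lt C ((one_lt_div hb).2 hab)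
  rw [div_pow, lt_div_iff₀ (pow_pos hb n)] at hn
  exact (h n).not_gt hn

variable {G : Type*} [Group G] [TopologicalSpace G] {α : ContEnd G} {U V : Subgroup G}

theorem displacementIndex_eq_relIndex_map (α : ContEnd G) (U : Subgroup G) :
    displacementIndex α U = U.relIndex (U.map α.1) :=
  Subgroup.inf_relIndex_left _ _

theorem displacementIndex_pow (α : ContEnd G) (n : ℕ) (U : Subgroup G) :
    displacementIndex (α ^ n) U = U.relIndex (U.map (iterateHom α.1 n)) :=
  Subgroup.inf_relIndex_left _ _

theorem displacementIndex_eq_one_iff : displacementIndex α U = 1 ↔ imageSubgroup α U ≤ U := by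
  rw [displacementIndex_eq_relIndex_map, Subgroup.relIndex_eq_one]
  rfl

theorem scale_le_displacementIndex (hU : IsCompactOpen U) : scale α ≤ displacementIndex α U :=
  Nat.sInf_le ⟨U, hU.isCompact, hU.isOpen, rfl⟩

theorem exists_displacementIndex_eq_scale (hG : ∃ U : Subgroup G, IsCompactOpen U)
    (α : ContEnd G) : ∃ U, IsCompactOpen U ∧ displacementIndex α U = scale α := by
  obtain ⟨U, hU⟩ := hG
  obtain ⟨V, hVc, hVo, hV⟩ := Nat.sInf_mem (s := {m : ℕ | ∃ U : Subgroup G,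
    IsCompact (U : Set G) ∧ IsOpen (U : Set G) ∧ m = displacementIndex α U})
    ⟨_, U, hU.isCompact, hU.isOpen, rfl⟩
  exact ⟨V, ⟨hVc, hVo⟩, hV.symm⟩

variable [IsTopologicalGroup G]

theorem IsCompactOpen.displacementIndex_pos (hU : IsCompactOpen U) (α : ContEnd G) :
    0 < displacementIndex α U := by
  rw [displacementIndex_eq_relIndex_map]
  exact Nat.pos_of_ne_zero (hU.relIndex_map_ne_zero α.2)

theorem IsCompactOpen.displacementIndex_mul_le (hU : IsCompactOpen U) (α β : ContEnd G) :
    displacementIndex (α * β) U ≤ displacementIndex α U * displacementIndex β U := by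
  simp only [displacementIndex_eq_relIndex_map]
  have hcomap : (U.comap α.1).relIndex U = U.relIndex (U.map α.1) := Subgroup.relIndex_comap U α.1 U
  calc U.relIndex (U.map (α * β).1) = U.relIndex ((U.map β.1).map α.1) :=
        congrArg U.relIndex (Subgroup.map_map U α.1 β.1).symm
    _ = (U.comap α.1).relIndex (U.map β.1) := (Subgroup.relIndex_comap U α.1 _).symm
    _ ≤ (U.comap α.1).relIndex U * U.relIndex (U.map β.1) :=
        relIndex_le_relIndex_mul_relIndex (hcomap.trans_ne (hU.relIndex_map_ne_zero α.2))
          (hU.relIndex_map_ne_zero β.2)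
    _ = U.relIndex (U.map α.1) * U.relIndex (U.map β.1) := by rw [hcomap]

theorem IsCompactOpen.displacementIndex_pow_le (hU : IsCompactOpen U) (α : ContEnd G) (n : ℕ) :
    displacementIndex (α ^ n) U ≤ displacementIndex α U ^ n := by
  induction n with
  | zero =>
    rw [pow_zero, pow_zero, displacementIndex_eq_one_iff.2 (Subgroup.map_id U).le]
  | succ n ih =>
    rw [pow_succ, pow_succ]
    exact (hU.displacementIndex_mul_le _ _).trans (Nat.mul_le_mul_right _ ih)

theorem IsCompactOpen.displacementIndex_le_mul (hU : IsCompactOpen U) (hV : IsCompactOpen V)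
    (α : ContEnd G) :
    displacementIndex α V ≤ U.relIndex V * V.relIndex U * displacementIndex α U := by
  simp only [displacementIndex_eq_relIndex_map]
  have hVU := relIndex_ne_zero_of_isOpen_of_isCompact hV.isOpen hU.isCompact
  have hUV := relIndex_ne_zero_of_isOpen_of_isCompact hU.isOpen hV.isCompact
  have hcomap (W : Subgroup G) : (U.comap α.1).relIndex W = U.relIndex (W.map α.1) :=
    Subgroup.relIndex_comap U α.1 W
  have hUαV : U.relIndex (V.map α.1) ≠ 0 :=
    relIndex_ne_zero_of_isOpen_of_isCompact hU.isOpen (isCompact_map α.2 hV.isCompact)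
  have hpull : (U.comap α.1).relIndex V ≤ (U.comap α.1).relIndex U * U.relIndex V :=
    relIndex_le_relIndex_mul_relIndex ((hcomap U).trans_ne (hU.relIndex_map_ne_zero α.2)) hUV
  calc V.relIndex (V.map α.1) ≤ V.relIndex U * U.relIndex (V.map α.1) :=
        relIndex_le_relIndex_mul_relIndex hVU hUαV
    _ ≤ V.relIndex U * (U.relIndex (U.map α.1) * U.relIndex V) := by
        rw [← hcomap V, ← hcomap U]
        exact Nat.mul_le_mul_left _ hpull
    _ = U.relIndex V * V.relIndex U * U.relIndex (U.map α.1) := by ring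

theorem scale_pos (hG : ∃ U : Subgroup G, IsCompactOpen U) (α : ContEnd G) : 0 < scale α := by
  obtain ⟨U, hU, hUα⟩ := exists_displacementIndex_eq_scale hG α
  exact hUα ▸ hU.displacementIndex_pos α

theorem scale_eq_one_iff (hG : ∃ U : Subgroup G, IsCompactOpen U) (α : ContEnd G) :
    scale α = 1 ↔ ∃ U, IsCompactOpen U ∧ imageSubgroup α U ≤ U := by
  constructor
  · intro h
    obtain ⟨U, hU, hUα⟩ := exists_displacementIndex_eq_scale hG α
    exact ⟨U, hU, displacementIndex_eq_one_iff.1 (hUα.trans h)⟩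
  · rintro ⟨U, hU, hUα⟩
    exact le_antisymm ((scale_le_displacementIndex hU).trans_eq
      (displacementIndex_eq_one_iff.2 hUα)) (scale_pos ⟨U, hU⟩ α)

theorem scale_pow_le (hG : ∃ U : Subgroup G, IsCompactOpen U) (α : ContEnd G) (n : ℕ) :
    scale (α ^ n) ≤ scale α ^ n := by
  obtain ⟨U, hU, hUα⟩ := exists_displacementIndex_eq_scale hG α
  exact hUα ▸ (scale_le_displacementIndex hU).trans (hU.displacementIndex_pow_le α n)

variable [T2Space G]

theorem IsCompactOpen.exists_scale_pow_le_mul_displacementIndex (hU : IsCompactOpen U)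
    (α : ContEnd G) : ∃ C, ∀ n, scale α ^ n ≤ C * displacementIndex (α ^ n) U := by
  obtain ⟨V, hV, hVα⟩ := hU.exists_forall_pow_le_relIndex_map α.2 fun W hW =>
    (scale_le_displacementIndex hW).trans_eq (displacementIndex_eq_relIndex_map α W)
  refine ⟨U.relIndex V * V.relIndex U, fun n => ?_⟩
  calc scale α ^ n ≤ displacementIndex (α ^ n) V := displacementIndex_pow α n V ▸ hVα n
    _ ≤ U.relIndex V * V.relIndex U * displacementIndex (α ^ n) U :=
        hU.displacementIndex_le_mul hV (α ^ n)

theorem pow_scale_le (hG : ∃ U : Subgroup G, IsCompactOpen U) (α : ContEnd G) (k : ℕ) :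
    scale α ^ k ≤ scale (α ^ k) := by
  obtain ⟨U, hU, hUα⟩ := exists_displacementIndex_eq_scale hG (α ^ k)
  obtain ⟨C, hC⟩ := hU.exists_scale_pow_le_mul_displacementIndex α
  have hgrowth (n : ℕ) : (scale α ^ k) ^ n ≤ C * scale (α ^ k) ^ n := calc
    (scale α ^ k) ^ n = scale α ^ (k * n) := (pow_mul _ _ _).symm
    _ ≤ C * displacementIndex ((α ^ k) ^ n) U := pow_mul α k n ▸ hC (k * n)
    _ ≤ C * scale (α ^ k) ^ n :=
        hUα ▸ Nat.mul_le_mul_left C (hU.displacementIndex_pow_le (α ^ k) n)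
  have hpos : (0 : ℝ) < scale (α ^ k) := by exact_mod_cast scale_pos hG (α ^ k)
  have hle := le_of_forall_pow_le_mul_pow (a := ((scale α ^ k : ℕ) : ℝ)) (C := C) hpos fun n => by
    exact_mod_cast hgrowth n
  exact_mod_cast hle

end Scale

end EndScale

theorem mainTheorem3_general {G : Type*} [Group G] [TopologicalSpace G] [IsTopologicalGroup G]
    [T2Space G] (hG : ∃ U : Subgroup G, EndScale.IsCompactOpen U) :
    (∀ α : ContEnd G, 0 < scale α) ∧
    (∀ α : ContEnd G, scale α = 1 ↔
      ∃ U : Subgroup G, IsCompact (U : Set G) ∧ IsOpen (U : Set G) ∧ imageSubgroup α U ≤ U) ∧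
    (∀ (α : ContEnd G) (n : ℕ), scale (α ^ n) = scale α ^ n) := by
  refine ⟨EndScale.scale_pos hG, fun α => ?_, fun α n =>
    (EndScale.scale_pow_le hG α n).antisymm (EndScale.pow_scale_le hG α n)⟩
  rw [EndScale.scale_eq_one_iff hG α]
  exact ⟨fun ⟨U, hU, hUα⟩ => ⟨U, hU.isCompact, hU.isOpen, hUα⟩,
    fun ⟨U, hUc, hUo, hUα⟩ => ⟨U, ⟨hUc, hUo⟩, hUα⟩⟩

theorem mainTheorem3 {G : Type*} [Group G] [TopologicalSpace G] [IsTopologicalGroup G]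
    [LocallyCompactSpace G] [TotallyDisconnectedSpace G] :
    (∀ α : ContEnd G, 0 < scale α) ∧
    (∀ α : ContEnd G, scale α = 1 ↔
      ∃ U : Subgroup G, IsCompact (U : Set G) ∧ IsOpen (U : Set G) ∧ imageSubgroup α U ≤ U) ∧
    (∀ (α : ContEnd G) (n : ℕ), scale (α ^ n) = scale α ^ n) :=
  mainTheorem3_general EndScale.exists_isCompactOpen
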